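/- \textbf{Theorem (Van Kampen's theorem).} Let $X$ be a topological space, let $(X_j)_{j\in J}$ be a family of open, path-connected subspaces with $X=\bigcup_{j\in J}X_j$, and let $x_0\in\bigcap_{j\in J}X_j$. Let $\iota_j\colon \pi_1(X_j,x_0)\to\pi_1(X,x_0)$ be the homomorphism induced by the inclusion $X_j\subseteq X$, let $\coprod_{j\in J}\pi_1(X_j,x_0)$ be the free product of the groups $\pi_1(X_j,x_0)$, with canonical homomorphisms $\varphi_j\colon\pi_1(X_j,x_0)\to\coprod_{j\in J}\pi_1(X_j,x_0)$, and let $$\Phi\colon \coprod_{j\in J}\pi_1(X_j,x_0)\to\pi_1(X,x_0)$$ be the unique homomorphism with $\Phi\circ\varphi_j=\iota_j$ for all $j\in J$. For $i,j\in J$ let $\iota_{ij}\colon\pi_1(X_i\cap X_j,x_0)\to\pi_1(X_i,x_0)$ and $\iota_{ji}\colon\pi_1(X_i\cap X_j,x_0)\to\pi_1(X_j,x_0)$ be the homomorphisms induced by the inclusions, and let $N$ be the smallest normal subgroup of $\coprod_{j\in J}\pi_1(X_j,x_0)$ containing all elements $\varphi_i(\iota_{ij}(g))\,\varphi_j(\iota_{ji}(g))^{-1}$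 with $i,j\in J$ and $g\in\pi_1(X_i\cap X_j,x_0)$. \begin{enumerate} \item If $X_i\cap X_j$ is path connected for all $i,j\in J$, then $\Phi$ is surjective. \item If $X_i\cap X_j\cap X_k$ is path connected for all $i,j,k\in J$ (not necessarily distinct), then $\ker\Phi=N$. \end{enumerate} -/

import Mathlib

namespace VanKampen

/-- The homomorphism `π₁(A, x₀) → π₁(X, x₀)` induced by the inclusion of a subspace `A` of `X`. -/
noncomputable def inclHom {X : Type*} [TopologicalSpace X] (A : Set X) (x₀ : X) (hx : x₀ ∈ A) :
    FundamentalGroup A ⟨x₀, hx⟩ →* FundamentalGroup X x₀ :=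
  FundamentalGroup.map (⟨Subtype.val, continuous_subtype_val⟩ : C(A, X)) ⟨x₀, hx⟩

/-- The homomorphism `π₁(A, x₀) → π₁(B, x₀)` induced by the inclusion of subspaces `A ⊆ B`. -/
noncomputable def inclHomOfSubset {X : Type*} [TopologicalSpace X] {A B : Set X} (h : A ⊆ B)
    (x₀ : X) (hx : x₀ ∈ A) :
    FundamentalGroup A ⟨x₀, hx⟩ →* FundamentalGroup B ⟨x₀, h hx⟩ :=
  FundamentalGroup.map (⟨Set.inclusion h, continuous_inclusion h⟩ : C(A, B)) ⟨x₀, hx⟩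

/-- The free product (coproduct of groups) of the fundamental groups `π₁(U j, x₀)`. -/
abbrev FreeProd {X J : Type*} [TopologicalSpace X] (U : J → Set X) (x₀ : X)
    (hx : ∀ j, x₀ ∈ U j) : Type _ :=
  Monoid.CoprodI (fun j => FundamentalGroup (U j) ⟨x₀, hx j⟩)

/-- The canonical homomorphism from `π₁(U j, x₀)` to the free product. -/
noncomputable def toFreeProd {X J : Type*} [TopologicalSpace X] (U : J → Set X) (x₀ : X)
    (hx : ∀ j, x₀ ∈ U j) (j : J) :
    FundamentalGroup (U j) ⟨x₀, hx j⟩ →* FreeProd U x₀ hx :=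
  Monoid.CoprodI.of (M := fun j => FundamentalGroup (U j) ⟨x₀, hx j⟩) (i := j)

/-- The homomorphism `Φ` from the free product to `π₁(X, x₀)` which restricts on each factor
`π₁(U j, x₀)` to the homomorphism induced by the inclusion. -/
noncomputable def Phi {X J : Type*} [TopologicalSpace X] (U : J → Set X) (x₀ : X)
    (hx : ∀ j, x₀ ∈ U j) : FreeProd U x₀ hx →* FundamentalGroup X x₀ :=
  Monoid.CoprodI.lift (fun j => inclHom (U j) x₀ (hx j))

/-- The smallest normal subgroup of the free product that contains `ι_{ij}(g) ι_{ji}(g)⁻¹` for all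
`i`, `j` and all `g` in `π₁(U i ∩ U j, x₀)`. -/
noncomputable def N {X J : Type*} [TopologicalSpace X] (U : J → Set X) (x₀ : X)
    (hx : ∀ j, x₀ ∈ U j) : Subgroup (FreeProd U x₀ hx) :=
  Subgroup.normalClosure
    {w | ∃ (i j : J) (g : FundamentalGroup ↑(U i ∩ U j) ⟨x₀, hx i, hx j⟩),
      w = toFreeProd U x₀ hx i
            (inclHomOfSubset (Set.inter_subset_left : U i ∩ U j ⊆ U i) x₀ ⟨hx i, hx j⟩ g) *
          (toFreeProd U x₀ hx j
            (inclHomOfSubset (Set.inter_subset_right : U i ∩ U j ⊆ U j) x₀ ⟨hx i, hx j⟩ g))⁻¹}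

end VanKampen

namespace VanKampen

open unitInterval Set CategoryTheory

/-! Surjectivity: call a path from `x₀` to `x` good if closing it up by a path back to `x₀` inside
any `U i` containing `x` gives a loop in the range of `Phi`. Connected pairwise intersections make
one such return path as good as any other. Goodness therefore does not change along short pieces of
a path, and hence not along a whole path.

Kernel: `N ≤ ker` because both images of a loop in `U i ∩ U j` become the same loop in `X`. For the
converse it is enough to construct a homomorphism from `π₁(X, x₀)` to `G = FreeProd / N` whose
composite with `Phi` is the quotient map up to conjugation. It is built as a parallel transport. The
maps `π₁(U j, x₀) → G` agree on pairwise intersections; connected triple intersections allow them to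
be extended from loops to paths ending at any point (`Compatible.exists_extension`), and quotients
of the extended values define the transport along paths lying in one `U i`
(`Compatible.exists_localTransport`).

A local transport extends to all paths: `exists_isPotential` integrates it along a subdivision, and
two solutions differ by a locally constant, hence constant, factor. The same uniqueness gives
multiplicativity (`holonomy_trans`) and homotopy invariance (`holonomy_eq_of_homotopic`). -/

/-- The restriction of `γ` to the segment from `s` to `t`, reparametrized by the unit interval. -/
def segment {X : Type*} [TopologicalSpace X] (γ : C(I, X)) (s t : I) : C(I, X) :=
  γ.comp ⟨Icc.convexComb s t, Icc.continuous_convexComb s t⟩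

/-! ### Segments of paths, and the Lebesgue number -/

section segment

variable {X : Type*} [TopologicalSpace X]

@[simp]
theorem segment_apply (γ : C(I, X)) (s t r : I) :
    segment γ s t r = γ (Icc.convexComb s t r) := rfl

@[simp]
theorem segment_zero_one (γ : C(I, X)) : segment γ 0 1 = γ := by
  ext r; simp

theorem segment_self (γ : C(I, X)) (s : I) : segment γ s s = .const I (γ s) := by
  ext r; simp

theorem segment_segment (γ : C(I, X)) (a b s t : I) :
    segment (segment γ a b) s t
      = segment γ (Icc.convexComb a b s) (Icc.convexComb a b t) := by
  ext r
  simp only [segment_apply]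
  congr 1
  ext
  simp only [Icc.coe_convexComb]
  ring

theorem convexComb_mem_Icc {s t : I} (h : s ≤ t) (r : I) : Icc.convexComb s t r ∈ Icc s t :=
  ⟨Icc.le_convexComb h r, Icc.convexComb_le h r⟩

theorem convexComb_mono {a b : I} (h : a ≤ b) {s t : I} (hst : s ≤ t) :
    Icc.convexComb a b s ≤ Icc.convexComb a b t := by
  rw [← Subtype.coe_le_coe, Icc.coe_convexComb, Icc.coe_convexComb]
  have h1 : (a : ℝ) ≤ b := h
  have h2 : (s : ℝ) ≤ t := hst
  nlinarith

theorem dist_le_of_mem_Icc {s t r : I} (hr : r ∈ Icc s t) : dist r s ≤ dist s t := by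
  rw [Subtype.dist_eq, Subtype.dist_eq, Real.dist_eq, Real.dist_eq,
    abs_sub_comm (s : ℝ)]
  have h1 : (s : ℝ) ≤ r := hr.1
  have h2 : (r : ℝ) ≤ t := hr.2
  rw [abs_of_nonneg (by linarith), abs_of_nonneg (by linarith)]
  linarith

theorem dist_convexComb_le (a b s t : I) :
    dist (Icc.convexComb a b s) (Icc.convexComb a b t) ≤ dist s t := by
  rw [Subtype.dist_eq, Subtype.dist_eq, Real.dist_eq, Real.dist_eq, Icc.coe_convexComb,
    Icc.coe_convexComb]
  have h1 : |(b : ℝ) - a| ≤ 1 := by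
    rw [abs_le]; constructor <;> linarith [a.2.1, a.2.2, b.2.1, b.2.2]
  calc _ = |(b : ℝ) - a| * |(s : ℝ) - t| := by rw [← abs_mul]; congr 1; ring
    _ ≤ 1 * |(s : ℝ) - t| := by gcongr
    _ = _ := one_mul _

/-- A function on the unit interval which does not distinguish points at distance less than `δ` is
constant. -/
theorem eq_of_forall_dist_lt {α : Type*} (f : I → α) {δ : ℝ} (hδ : 0 < δ)
    (h : ∀ s t, s ≤ t → dist s t < δ → f s = f t) (s t : I) : f s = f t := by
  refine IsLocallyConstant.apply_eq_of_preconnectedSpace ?_ s t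
  refine (IsLocallyConstant.iff_eventually_eq f).2 fun a => ?_
  filter_upwards [Metric.ball_mem_nhds a hδ] with b hb
  rcases le_total a b with hab | hab
  · exact (h a b hab (by rwa [dist_comm])).symm
  · exact h b a hab hb

/-- Lebesgue's lemma for the pulled-back cover. It is used with `Y = I` for paths and with `Y = I ×
I` for homotopies. -/
theorem exists_dist_lt_mem {J Y : Type*} [PseudoMetricSpace Y] [CompactSpace Y] {U : J → Set X}
    (hopen : ∀ j, IsOpen (U j)) (hcover : ⋃ j, U j = univ) (H : C(Y, X)) :
    ∃ δ > 0, ∀ p, ∃ i, ∀ q, dist q p < δ → H q ∈ U i := by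
  obtain ⟨δ, hδ, h⟩ := lebesgue_number_lemma_of_metric (s := (univ : Set Y)) isCompact_univ
    (c := fun j => H ⁻¹' U j) (fun j => (hopen j).preimage H.continuous)
    (by rw [← preimage_iUnion, hcover, preimage_univ])
  exact ⟨δ, hδ, fun p => (h p trivial).imp fun i hi q hq => hi hq⟩

end segment

/-! ### Parallel transport and its holonomy -/

/-- The square obtained from `H` by restricting it to a rectangle. -/
def rectangle {X : Type*} [TopologicalSpace X] (H : C(I × I, X)) (s s' t t' : I) : C(I × I, X) :=
  H.comp ⟨fun p => (Icc.convexComb s s' p.2, Icc.convexComb t t' p.1),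
    ((Icc.continuous_convexComb s s').comp continuous_snd).prodMk
      ((Icc.continuous_convexComb t t').comp continuous_fst)⟩

/-- The path `r ↦ K (r, b)` in a square `K`. -/
def horizontal {X : Type*} [TopologicalSpace X] (K : C(I × I, X)) (b : I) : C(I, X) :=
  K.comp ⟨fun r => (r, b), by fun_prop⟩

/-- The path `r ↦ K (a, r)` in a square `K`. -/
def vertical {X : Type*} [TopologicalSpace X] (K : C(I × I, X)) (a : I) : C(I, X) :=
  K.comp ⟨fun r => (a, r), by fun_prop⟩

/-- A parallel transport with values in a group `G`, along the paths in `X` each of which lies in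
one of the sets `U i`. It is trivial on constant paths, and around squares that lie in one of the
sets `U i`. -/
structure LocalTransport {X J : Type*} [TopologicalSpace X] (U : J → Set X) (G : Type*)
    [Group G] where
  /-- The transport along a path; its value is irrelevant unless the path lies in some `U i`. -/
  val : C(I, X) → G
  val_const : ∀ x, val (.const I x) = 1
  val_square : ∀ (i : J) (K : C(I × I, X)), (∀ p, K p ∈ U i) →
    val (vertical K 1) * val (horizontal K 0) = val (horizontal K 1) * val (vertical K 0)

namespace LocalTransport

variable {X J : Type*} [TopologicalSpace X] {U : J → Set X} {G : Type*} [Group G]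
  (T : LocalTransport U G)

/-- A triangle is a square with one constant side: the left edge of `K` stays at `γ a`, and the
other three edges are the three segments. -/
theorem val_segment_mul {i : J} {γ : C(I, X)} {a b c : I} (hab : a ≤ b) (hbc : b ≤ c)
    (hU : ∀ r ∈ Icc a c, γ r ∈ U i) :
    T.val (segment γ b c) * T.val (segment γ a b) = T.val (segment γ a c) := by
  let K : C(I × I, X) := γ.comp ⟨fun p => Icc.convexComb a (Icc.convexComb b c p.2) p.1,
    Icc.continuous_convexComb_prod.comp (continuous_const.prodMk
      (((Icc.continuous_convexComb b c).comp continuous_snd).prodMk continuous_fst))⟩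
  have h := T.val_square i K fun p => hU _ <| by
    have h1 := convexComb_mem_Icc hbc p.2
    have h2 := convexComb_mem_Icc (hab.trans h1.1) p.1
    exact ⟨h2.1, h2.2.trans h1.2⟩
  have e1 : vertical K 1 = segment γ b c := by ext r; simp [vertical, K]
  have e2 : horizontal K 0 = segment γ a b := by ext r; simp [horizontal, K]
  have e3 : horizontal K 1 = segment γ a c := by ext r; simp [horizontal, K]
  have e4 : vertical K 0 = .const I (γ a) := by ext r; simp [vertical, K]
  rwa [e1, e2, e3, e4, T.val_const, mul_one] at h

/-- A function on the unit interval which changes by the transport along `γ`. -/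
def IsPotential (γ : C(I, X)) (u : I → G) : Prop :=
  ∀ (i : J) (s t : I), s ≤ t → (∀ r ∈ Icc s t, γ r ∈ U i) → u t = T.val (segment γ s t) * u s

/-- Subdivide so that each piece lies in one `U j`, and extend the potential over one piece at a
time. -/
theorem exists_isPotential (hopen : ∀ j, IsOpen (U j)) (hcover : ⋃ j, U j = univ)
    (γ : C(I, X)) : ∃ u, u 0 = 1 ∧ T.IsPotential γ u := by
  obtain ⟨d, d0, dmono, ⟨n, hn⟩, hd⟩ := exists_monotone_Icc_subset_open_cover_unitInterval
    (c := fun j => γ ⁻¹' U j) (fun j => (hopen j).preimage γ.continuous)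
    (by rw [← preimage_iUnion, hcover, preimage_univ])
  have key : ∀ n, ∃ u : I → G, u 0 = 1 ∧ ∀ (i : J) (s t : I), s ≤ t → t ≤ d n →
      (∀ r ∈ Icc s t, γ r ∈ U i) → u t = T.val (segment γ s t) * u s := by
    intro n
    induction n with
    | zero =>
      refine ⟨fun _ => 1, rfl, fun i s t hst ht _ => ?_⟩
      rw [d0] at ht
      have ht0 : t = 0 := le_antisymm ht nonneg'
      have hs0 : s = 0 := le_antisymm (hst.trans ht) nonneg'
      rw [ht0, hs0, segment_self, T.val_const, mul_one]
    | succ n ih =>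
      obtain ⟨u, u0, hu⟩ := ih
      obtain ⟨j, hj⟩ := hd n
      -- Past `d n`, transport from `d n`. The values beyond `d (n + 1)` are irrelevant, since the
      -- claim only concerns `t ≤ d (n + 1)`.
      refine ⟨fun r => if r ≤ d n then u r else T.val (segment γ (d n) r) * u (d n),
        by simp [u0], fun i s t hst ht hU => ?_⟩
      by_cases htn : t ≤ d n
      · simpa [htn, hst.trans htn] using hu i s t hst htn hU
      · have htn' : d n ≤ t := (not_le.1 htn).le
        by_cases hsn : s ≤ d n
        · simp only [htn, hsn, if_true, if_false]
          rw [hu i s (d n) hsn le_rfl fun r hr => hU r ⟨hr.1, hr.2.trans htn'⟩, ← mul_assoc,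
            T.val_segment_mul hsn htn' hU]
        · have hsn' : d n ≤ s := (not_le.1 hsn).le
          simp only [htn, hsn, if_false]
          rw [← mul_assoc, T.val_segment_mul hsn' hst fun r hr => hj ⟨hr.1, hr.2.trans ht⟩]
  obtain ⟨u, u0, hu⟩ := key n
  exact ⟨u, u0, fun i s t hst hU => hu i s t hst (by rw [hn n le_rfl]; exact le_one') hU⟩

variable {T} in
/-- A potential is determined by the transport along short segments. -/
theorem IsPotential.eq_of_dist_lt (hopen : ∀ j, IsOpen (U j)) (hcover : ⋃ j, U j = univ)
    {γ : C(I, X)} {u v : I → G} (hu : T.IsPotential γ u) {δ : ℝ} (hδ : 0 < δ)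
    (hv : ∀ s t, s ≤ t → dist s t < δ → v t = T.val (segment γ s t) * v s) (a b : I) :
    (v a)⁻¹ * u a = (v b)⁻¹ * u b := by
  obtain ⟨ε, hε, h⟩ := exists_dist_lt_mem hopen hcover γ
  refine eq_of_forall_dist_lt (fun t => (v t)⁻¹ * u t) (lt_min hδ hε) (fun s t hst hd => ?_) a b
  obtain ⟨i, hi⟩ := h s
  have h1 := hv s t hst (hd.trans_le (min_le_left _ _))
  have h2 := hu i s t hst fun r hr =>
    hi r ((dist_le_of_mem_Icc hr).trans_lt (hd.trans_le (min_le_right _ _)))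
  simp only [h1, h2]
  group

variable {T} in
theorem IsPotential.dist_lt (hopen : ∀ j, IsOpen (U j)) (hcover : ⋃ j, U j = univ)
    {γ : C(I, X)} {u : I → G} (hu : T.IsPotential γ u) :
    ∃ δ > 0, ∀ s t, s ≤ t → dist s t < δ → u t = T.val (segment γ s t) * u s := by
  obtain ⟨ε, hε, h⟩ := exists_dist_lt_mem hopen hcover γ
  refine ⟨ε, hε, fun s t hst hd => ?_⟩
  obtain ⟨i, hi⟩ := h s
  exact hu i s t hst fun r hr => hi r ((dist_le_of_mem_Icc hr).trans_lt hd)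

/-- The transport along an arbitrary path. -/
noncomputable def holonomy (hopen : ∀ j, IsOpen (U j)) (hcover : ⋃ j, U j = univ)
    (γ : C(I, X)) : G :=
  (T.exists_isPotential hopen hcover γ).choose 1

variable (hopen : ∀ j, IsOpen (U j)) (hcover : ⋃ j, U j = univ)

/-- The working tool for computing holonomies: any `v` that changes by the transport along short
segments, with no condition on `v 0`, differs from the chosen potential by a constant right factor.
-/
theorem holonomy_eq_of_dist_lt {γ : C(I, X)} {v : I → G} {δ : ℝ} (hδ : 0 < δ)
    (hv : ∀ s t, s ≤ t → dist s t < δ → v t = T.val (segment γ s t) * v s) :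
    v 1 = T.holonomy hopen hcover γ * v 0 := by
  obtain ⟨u0, hu⟩ := (T.exists_isPotential hopen hcover γ).choose_spec
  have h := hu.eq_of_dist_lt hopen hcover hδ hv 0 1
  rw [u0, mul_one] at h
  change _ = (v 1)⁻¹ * T.holonomy hopen hcover γ at h
  have h' := congrArg (v 1 * · * v 0) h
  simpa using h'

theorem holonomy_eq_val {i : J} {γ : C(I, X)} (hγ : ∀ r, γ r ∈ U i) :
    T.holonomy hopen hcover γ = T.val γ := by
  obtain ⟨u0, hu⟩ := (T.exists_isPotential hopen hcover γ).choose_spec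
  have h := hu i 0 1 zero_le_one fun r _ => hγ r
  rwa [u0, mul_one, segment_zero_one] at h

/-- Reparametrizing `[a, b]` by `I` does not increase the distance in `[a, b]` above that in `I`, so
the restricted potential still satisfies the relation on short segments. -/
theorem IsPotential.eq_holonomy_segment {γ : C(I, X)} {u : I → G} (hu : T.IsPotential γ u)
    {a b : I} (hab : a ≤ b) : u b = T.holonomy hopen hcover (segment γ a b) * u a := by
  obtain ⟨δ, hδ, h⟩ := hu.dist_lt hopen hcover
  have := T.holonomy_eq_of_dist_lt hopen hcover (γ := segment γ a b)
    (v := fun r => u (Icc.convexComb a b r)) hδ fun s t hst hd => by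
      rw [segment_segment]
      exact h _ _ (convexComb_mono hab hst) ((dist_convexComb_le a b s t).trans_lt hd)
  simpa using this

theorem holonomy_segment_mul (γ : C(I, X)) (a : I) :
    T.holonomy hopen hcover (segment γ a 1) * T.holonomy hopen hcover (segment γ 0 a)
      = T.holonomy hopen hcover γ := by
  obtain ⟨u, u0, hu⟩ := T.exists_isPotential hopen hcover γ
  have h1 := IsPotential.eq_holonomy_segment T hopen hcover hu (nonneg' (t := a))
  have h2 := IsPotential.eq_holonomy_segment T hopen hcover hu (le_one' (t := a))
  have h3 := IsPotential.eq_holonomy_segment T hopen hcover hu (zero_le_one (α := I))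
  rw [h1, u0, h3, u0] at h2
  simpa using h2.symm

theorem holonomy_trans {x y z : X} (p : Path x y) (q : Path y z) :
    T.holonomy hopen hcover (p.trans q)
      = T.holonomy hopen hcover q * T.holonomy hopen hcover p := by
  let a : I := ⟨1 / 2, by norm_num, by norm_num⟩
  have e1 : segment (p.trans q : C(I, X)) 0 a = p := by
    ext r
    have h : ((Icc.convexComb 0 a r : I) : ℝ) = r / 2 := by simp [Icc.coe_convexComb, a]; ring
    have h' : (r : ℝ) / 2 ≤ 1 / 2 := by linarith [r.2.2]
    change (p.trans q) (Icc.convexComb 0 a r) = p r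
    rw [Path.trans_apply, dif_pos (h.trans_le h')]
    congr 1
    ext
    simp only [h]
    ring
  have e2 : segment (p.trans q : C(I, X)) a 1 = q := by
    ext r
    have h : ((Icc.convexComb a 1 r : I) : ℝ) = (1 + r) / 2 := by
      simp [Icc.coe_convexComb, a]; ring
    change (p.trans q) (Icc.convexComb a 1 r) = q r
    rw [Path.trans_apply]
    split_ifs with hr
    -- The midpoint falls in the first branch of `trans`, where both paths have the value `y`.
    · have hr0 : r = 0 := by
        rw [h] at hr
        exact le_antisymm (Subtype.coe_le_coe.1 (by rw [Icc.coe_zero]; linarith)) nonneg'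
      subst hr0
      rw [q.source]
      convert p.target
      simp [a]
    · congr 1
      ext
      simp only [h]
      ring
  rw [← T.holonomy_segment_mul hopen hcover (p.trans q : C(I, X)) a, e1, e2]

/-- It suffices to compare nearby stages `s ≤ s'` of the homotopy. Transport across from stage `s`
to stage `s'` carries a potential along one to a potential along the other, and it is trivial at the
fixed endpoints. -/
theorem holonomy_eq_of_homotopic {x y : X} {p q : Path x y} (hpq : p.Homotopic q) :
    T.holonomy hopen hcover p = T.holonomy hopen hcover q := by
  obtain ⟨H⟩ := hpq
  let K : C(I × I, X) := H.toContinuousMap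
  have hK0 : ∀ s, K (s, 0) = x := fun s => by simp [K]
  have hK1 : ∀ s, K (s, 1) = y := fun s => by simp [K]
  have ep : vertical K 0 = p := by ext r; simp [vertical, K]
  have eq : vertical K 1 = q := by ext r; simp [vertical, K]
  obtain ⟨δ, hδ, h⟩ := exists_dist_lt_mem hopen hcover K
  suffices ∀ s s', s ≤ s' → dist s s' < δ →
      T.holonomy hopen hcover (vertical K s) = T.holonomy hopen hcover (vertical K s') by
    rw [← ep, ← eq]
    exact eq_of_forall_dist_lt (fun s => T.holonomy hopen hcover (vertical K s)) hδ this 0 1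
  intro s s' hs hd
  obtain ⟨u, u0, hu⟩ := T.exists_isPotential hopen hcover (vertical K s)
  let V : I → G := fun t => T.val (segment (horizontal K t) s s')
  have V0 : V 0 = 1 := by
    have : segment (horizontal K 0) s s' = .const I x := by
      ext r; simp [horizontal, hK0]
    simp only [V, this, T.val_const]
  have V1 : V 1 = 1 := by
    have : segment (horizontal K 1) s s' = .const I y := by
      ext r; simp [horizontal, hK1]
    simp only [V, this, T.val_const]
  have hw := T.holonomy_eq_of_dist_lt hopen hcover (γ := vertical K s')
    (v := fun t => V t * u t) hδ fun t t' ht hdt => by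
      obtain ⟨i, hi⟩ := h (s, t)
      have hmem : ∀ a ∈ Icc s s', ∀ b ∈ Icc t t', K (a, b) ∈ U i := fun a ha b hb =>
        hi _ (max_lt ((dist_le_of_mem_Icc ha).trans_lt hd) ((dist_le_of_mem_Icc hb).trans_lt hdt))
      have hsq : V t' * T.val (segment (vertical K s) t t')
          = T.val (segment (vertical K s') t t') * V t := by
        -- `rectangle` swaps the coordinates, so its vertical edges run in the homotopy direction
        -- and give `V t` and `V t'`.
        have := T.val_square i (rectangle K s s' t t') fun p =>
          hmem _ (convexComb_mem_Icc hs p.2) _ (convexComb_mem_Icc ht p.1)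
        convert this using 3 <;> ext r <;> simp [rectangle, vertical, horizontal]
      rw [hu i t t' ht fun r hr => hmem s (left_mem_Icc.2 hs) r hr, ← mul_assoc, hsq, mul_assoc]
  have hu1 := IsPotential.eq_holonomy_segment T hopen hcover hu (zero_le_one (α := I))
  simp only [V0, V1, one_mul, u0, mul_one] at hw
  rw [u0, mul_one, segment_zero_one, hw] at hu1
  exact hu1.symm

/-- The homomorphism from the fundamental group given by a parallel transport. -/
noncomputable def toHom (x : X) : FundamentalGroup X x →* G :=
  MonoidHom.mk'
    (fun g => Quotient.lift (s := Path.Homotopic.setoid x x)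
      (fun p : Path x x => T.holonomy hopen hcover (p : C(I, X)))
      (fun _ _ h => T.holonomy_eq_of_homotopic hopen hcover h) g)
    (by
      rintro ⟨p⟩ ⟨q⟩
      -- The product in `FundamentalGroup` is composition of endomorphisms: the right factor is
      -- traversed first.
      exact T.holonomy_trans hopen hcover q p)

end LocalTransport

/-! ### Fundamental groupoids of subspaces -/

/-- The class of a path, given as a continuous map, in the fundamental groupoid. -/
def pathClass {Y : Type*} [TopologicalSpace Y] (γ : C(I, Y)) :
    FundamentalGroupoid.mk (γ 0) ⟶ FundamentalGroupoid.mk (γ 1) :=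
  Path.Homotopic.Quotient.mk ⟨γ, rfl, rfl⟩

/-- The morphism in the fundamental groupoid of `B` induced by one in that of a subspace `A ⊆ B`. -/
def inclArrow {X : Type*} [TopologicalSpace X] {A B : Set X} (h : A ⊆ B) {x y : X} {hx : x ∈ A}
    {hy : y ∈ A} (p : FundamentalGroupoid.mk (⟨x, hx⟩ : A) ⟶ FundamentalGroupoid.mk ⟨y, hy⟩) :
    FundamentalGroupoid.mk (⟨x, h hx⟩ : B) ⟶ FundamentalGroupoid.mk ⟨y, h hy⟩ :=
  (FundamentalGroupoid.map ⟨inclusion h, continuous_inclusion h⟩).map p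

theorem inclArrow_comp {X : Type*} [TopologicalSpace X] {A B : Set X} (h : A ⊆ B) {x y z : X}
    {hx : x ∈ A} {hy : y ∈ A} {hz : z ∈ A}
    (p : FundamentalGroupoid.mk (⟨x, hx⟩ : A) ⟶ FundamentalGroupoid.mk ⟨y, hy⟩)
    (q : FundamentalGroupoid.mk (⟨y, hy⟩ : A) ⟶ FundamentalGroupoid.mk ⟨z, hz⟩) :
    inclArrow h (p ≫ q) = inclArrow h p ≫ inclArrow h q :=
  (FundamentalGroupoid.map ⟨inclusion h, continuous_inclusion h⟩).map_comp p q

theorem inclArrow_inv {X : Type*} [TopologicalSpace X] {A B : Set X} (h : A ⊆ B) {x y : X}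
    {hx : x ∈ A} {hy : y ∈ A}
    (p : FundamentalGroupoid.mk (⟨x, hx⟩ : A) ⟶ FundamentalGroupoid.mk ⟨y, hy⟩) :
    inclArrow h (Groupoid.inv p) = Groupoid.inv (inclArrow h p) := by
  induction p using Path.Homotopic.Quotient.ind
  rfl

theorem inclArrow_inclArrow {X : Type*} [TopologicalSpace X] {A B C : Set X} (h : A ⊆ B)
    (h' : B ⊆ C) {x y : X} {hx : x ∈ A} {hy : y ∈ A}
    (p : FundamentalGroupoid.mk (⟨x, hx⟩ : A) ⟶ FundamentalGroupoid.mk ⟨y, hy⟩) :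
    inclArrow h' (inclArrow h p) = inclArrow (h.trans h') p := by
  induction p using Path.Homotopic.Quotient.ind
  rfl

theorem nonempty_hom_of_isPathConnected {X : Type*} [TopologicalSpace X] {A : Set X}
    (hA : IsPathConnected A) (a b : A) :
    Nonempty (FundamentalGroupoid.mk a ⟶ FundamentalGroupoid.mk b) := by
  have := isPathConnected_iff_pathConnectedSpace.1 hA
  exact ⟨Path.Homotopic.Quotient.mk (PathConnectedSpace.somePath a b)⟩

theorem map_comp_inv_mul {C G : Type*} [Groupoid C] [Group G] {a b : C} (f : End a →* G)
    (p q r : a ⟶ b) :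
    f (show End a from q ≫ Groupoid.inv r) * f (show End a from p ≫ Groupoid.inv q)
      = f (show End a from p ≫ Groupoid.inv r) := by
  rw [← map_mul, End.mul_def]
  simp

/-! ### From compatible homomorphisms to a local transport -/

section

variable {X J G : Type*} [TopologicalSpace X] [Group G] {U : J → Set X} {x₀ : X}
  {hx : ∀ j, x₀ ∈ U j}

/-- Homomorphisms from the groups `π₁(U j, x₀)` that agree on the groups `π₁(U i ∩ U j, x₀)`. -/
def Compatible (f : ∀ j, FundamentalGroup (U j) ⟨x₀, hx j⟩ →* G) : Prop :=
  ∀ (i j : J) (g : FundamentalGroup ↑(U i ∩ U j) ⟨x₀, hx i, hx j⟩),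
    f i (inclHomOfSubset (inter_subset_left : U i ∩ U j ⊆ U i) x₀ ⟨hx i, hx j⟩ g)
      = f j (inclHomOfSubset (inter_subset_right : U i ∩ U j ⊆ U j) x₀ ⟨hx i, hx j⟩ g)

/-- Going along `p` and back along `q` is a loop in `A ⊆ U i ∩ U j`. -/
theorem Compatible.map_comp_inv {f : ∀ j, FundamentalGroup (U j) ⟨x₀, hx j⟩ →* G}
    (hf : Compatible f) {i j : J} {A : Set X} (hi : A ⊆ U i) (hj : A ⊆ U j) {x : X} (h0 : x₀ ∈ A)
    (h : x ∈ A) (p q : FundamentalGroupoid.mk (⟨x₀, h0⟩ : A) ⟶ FundamentalGroupoid.mk ⟨x, h⟩) :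
    f i (inclArrow hi p ≫ Groupoid.inv (inclArrow hi q))
      = f j (inclArrow hj p ≫ Groupoid.inv (inclArrow hj q)) := by
  have h' := hf i j (inclArrow (subset_inter hi hj) (p ≫ Groupoid.inv q))
  rw [← inclArrow_inv, ← inclArrow_inv, ← inclArrow_comp, ← inclArrow_comp]
  rw [← inclArrow_inclArrow (subset_inter hi hj) inter_subset_left,
    ← inclArrow_inclArrow (subset_inter hi hj) inter_subset_right]
  exact h'

/-- Compatible homomorphisms extend to functions on the paths from `x₀` to a given point `x`. -/
theorem Compatible.exists_extension {f : ∀ j, FundamentalGroup (U j) ⟨x₀, hx j⟩ →* G}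
    (hf : Compatible f) (hcover : ⋃ j, U j = univ)
    (hU : ∀ i j k, IsPathConnected (U i ∩ U j ∩ U k)) (x : X) :
    ∃ E : ∀ i (h : x ∈ U i),
        (FundamentalGroupoid.mk (⟨x₀, hx i⟩ : U i) ⟶ FundamentalGroupoid.mk ⟨x, h⟩) → G,
      (∀ i h (g : FundamentalGroup (U i) ⟨x₀, hx i⟩) p, E i h (g ≫ p) = E i h p * f i g) ∧
      ∀ i j (h : x ∈ U i ∩ U j) (p : FundamentalGroupoid.mk (⟨x₀, hx i, hx j⟩ : ↑(U i ∩ U j)) ⟶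
          FundamentalGroupoid.mk ⟨x, h⟩),
        E i h.1 (inclArrow inter_subset_left p)
          = E j h.2 (inclArrow inter_subset_right p) := by
  have hU2 : ∀ i j, IsPathConnected (U i ∩ U j) := fun i j => by
    have := hU i j j
    rwa [inter_assoc, inter_self] at this
  obtain ⟨j, hj⟩ : ∃ j, x ∈ U j := mem_iUnion.1 (hcover ▸ mem_univ x)
  have k : ∀ (i : J) (h : x ∈ U i), FundamentalGroupoid.mk (⟨x₀, hx i, hx j⟩ : ↑(U i ∩ U j)) ⟶
    FundamentalGroupoid.mk ⟨x, h, hj⟩ := fun i h =>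
      (nonempty_hom_of_isPathConnected (hU2 i j) ⟨x₀, hx i, hx j⟩ ⟨x, h, hj⟩).some
  let m : FundamentalGroupoid.mk (⟨x₀, hx j⟩ : U j) ⟶ FundamentalGroupoid.mk ⟨x, hj⟩ :=
    inclArrow inter_subset_left (k j hj)
  -- Close `p` up inside `U i` by `k i`, and correct by the loop in `U j` that compares `k i` with
  -- the reference path `m`.
  refine ⟨fun i h p => f j (inclArrow inter_subset_right (k i h) ≫ Groupoid.inv m) *
    f i (p ≫ Groupoid.inv (inclArrow inter_subset_left (k i h))), fun i h g p => ?_,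
    fun i i' h p => ?_⟩
  · have : f i (g ≫ p ≫ Groupoid.inv (inclArrow inter_subset_left (k i h)))
        = f i (p ≫ Groupoid.inv (inclArrow inter_subset_left (k i h))) * f i g := by
      rw [← map_mul, End.mul_def]
    simp only [Category.assoc, mul_assoc]
    exact congrArg (_ * ·) this
  -- Triple intersections enter here. By `key`, both `k i` and `k i'` may be replaced by the common
  -- path `l`; then the correction factors coincide, and the remaining ones are images of the same
  -- loop in `U i ∩ U i'`.
  · obtain ⟨l⟩ := nonempty_hom_of_isPathConnected (hU i i' j) ⟨x₀, ⟨hx i, hx i'⟩, hx j⟩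
      ⟨x, h, hj⟩
    have key : ∀ (a : J) (ha : x ∈ U a) (hs : U i ∩ U i' ⊆ U a),
        f j (inclArrow inter_subset_right (k a ha) ≫ Groupoid.inv m) *
          f a (inclArrow hs p ≫ Groupoid.inv (inclArrow inter_subset_left (k a ha)))
        = f j (inclArrow inter_subset_right l ≫ Groupoid.inv m) *
          f a (inclArrow hs p ≫
            Groupoid.inv (inclArrow hs (inclArrow inter_subset_left l))) := by
      intro a ha hs
      let l' : FundamentalGroupoid.mk (⟨x₀, hx a, hx j⟩ : ↑(U a ∩ U j)) ⟶
        FundamentalGroupoid.mk ⟨x, ha, hj⟩ := inclArrow (inter_subset_inter_left _ hs) l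
      have e1 : inclArrow hs (inclArrow inter_subset_left l)
          = inclArrow inter_subset_left l' := by
        induction l using Path.Homotopic.Quotient.ind
        rfl
      have e2 : inclArrow inter_subset_right l
          = inclArrow inter_subset_right l' := by
        induction l using Path.Homotopic.Quotient.ind
        rfl
      rw [e1, e2]
      have h1 := map_comp_inv_mul (f a) (inclArrow hs p)
        (inclArrow inter_subset_left l') (inclArrow inter_subset_left (k a ha))
      have h2 := map_comp_inv_mul (f j) (inclArrow inter_subset_right l')
        (inclArrow inter_subset_right (k a ha)) m
      have h3 := hf.map_comp_inv (i := a) (j := j) inter_subset_left inter_subset_right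
        ⟨hx a, hx j⟩ ⟨ha, hj⟩ l' (k a ha)
      refine (congrArg (_ * ·) h1.symm).trans ?_
      refine Eq.trans ?_ (congrArg (· * _) h2)
      rw [mul_assoc]
      exact congrArg (_ * ·) (congrArg (· * _) h3)
    refine (key i h.1 inter_subset_left).trans (Eq.trans ?_ (key i' h.2 inter_subset_right).symm)
    exact congrArg (_ * ·) (hf.map_comp_inv _ _ _ _ p _)

/-- The relation holds already in the contractible square `I × I`, where any two parallel arrows are
equal; `K` transports it to `Y`. -/
theorem pathClass_square {Y : Type*} [TopologicalSpace Y] (K : C(I × I, Y)) :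
    (show FundamentalGroupoid.mk (K (0, 0)) ⟶ FundamentalGroupoid.mk (K (1, 0)) from
        pathClass (horizontal K 0)) ≫
      (show FundamentalGroupoid.mk (K (1, 0)) ⟶ FundamentalGroupoid.mk (K (1, 1)) from
        pathClass (vertical K 1)) =
    (show FundamentalGroupoid.mk (K (0, 0)) ⟶ FundamentalGroupoid.mk (K (0, 1)) from
        pathClass (vertical K 0)) ≫
      (show FundamentalGroupoid.mk (K (0, 1)) ⟶ FundamentalGroupoid.mk (K (1, 1)) from
        pathClass (horizontal K 1)) := by
  let M : FundamentalGroupoid (I × I) ⥤ FundamentalGroupoid Y := FundamentalGroupoid.map K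
  let b : FundamentalGroupoid.mk ((0, 0) : I × I) ⟶ FundamentalGroupoid.mk (1, 0) :=
    pathClass (horizontal (.id _) 0)
  let r : FundamentalGroupoid.mk ((1, 0) : I × I) ⟶ FundamentalGroupoid.mk (1, 1) :=
    pathClass (vertical (.id _) 1)
  let l : FundamentalGroupoid.mk ((0, 0) : I × I) ⟶ FundamentalGroupoid.mk (0, 1) :=
    pathClass (vertical (.id _) 0)
  let t : FundamentalGroupoid.mk ((0, 1) : I × I) ⟶ FundamentalGroupoid.mk (1, 1) :=
    pathClass (horizontal (.id _) 1)
  have : ContractibleSpace I := (convex_Icc (0 : ℝ) 1).contractibleSpace ⟨0, zero_mem⟩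
  have h : b ≫ r = l ≫ t := Subsingleton.elim (α := Path.Homotopic.Quotient _ _) _ _
  have h' := congrArg M.map h
  rw [M.map_comp, M.map_comp] at h'
  exact h'

/-- A path in `X` that lies in `A`, as a path in `A`. -/
def codRestrictPath (A : Set X) (γ : C(I, X)) (h : ∀ r, γ r ∈ A) : C(I, A) :=
  ⟨fun r => ⟨γ r, h r⟩, by fun_prop⟩

/-- Put `val γ = E (p ≫ γ) * (E p)⁻¹` for any `p` from `x₀` to the start of `γ` inside a `U i`
containing `γ`. The conjugating element `e` is the value of `E` on the constant path at `x₀`, which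
the choices made for `E` need not make trivial. -/
theorem Compatible.exists_localTransport {f : ∀ j, FundamentalGroup (U j) ⟨x₀, hx j⟩ →* G}
    (hf : Compatible f) (hconn : ∀ j, IsPathConnected (U j)) (hcover : ⋃ j, U j = univ)
    (hU : ∀ i j k, IsPathConnected (U i ∩ U j ∩ U k)) :
    ∃ (T : LocalTransport U G) (e : G), ∀ (i : J) (p : Path (⟨x₀, hx i⟩ : U i) ⟨x₀, hx i⟩),
      T.val (p.map continuous_subtype_val)
        = e * f i (Path.Homotopic.Quotient.mk p) * e⁻¹ := by
  have hU2 : ∀ i j, IsPathConnected (U i ∩ U j) := fun i j => by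
    have := hU i j j
    rwa [inter_assoc, inter_self] at this
  choose E hE hE' using hf.exists_extension hcover hU
  -- Independence of `p`: another choice changes both factors by the same `f i g`, which cancels.
  have hquot : ∀ (i : J) {x y : X} (hxi : x ∈ U i) (hyi : y ∈ U i)
      (q : FundamentalGroupoid.mk (⟨x, hxi⟩ : U i) ⟶ FundamentalGroupoid.mk ⟨y, hyi⟩)
      (p p' : FundamentalGroupoid.mk (⟨x₀, hx i⟩ : U i) ⟶ FundamentalGroupoid.mk ⟨x, hxi⟩),
      E y i hyi (p ≫ q) * (E x i hxi p)⁻¹ = E y i hyi (p' ≫ q) * (E x i hxi p')⁻¹ := by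
    intro i x y hxi hyi q p p'
    let g : FundamentalGroup (U i) ⟨x₀, hx i⟩ := p ≫ Groupoid.inv p'
    have e1 : p = g ≫ p' := by simp [g]
    rw [e1, Category.assoc, hE, hE]
    group
  -- Independence of `i`: take `p` inside `U i ∩ U j`, where the two extensions agree.
  have hloc : ∀ (i j : J) (γ : C(I, X)) (hi : ∀ r, γ r ∈ U i) (hj : ∀ r, γ r ∈ U j)
      (p : FundamentalGroupoid.mk (⟨x₀, hx i⟩ : U i) ⟶ FundamentalGroupoid.mk ⟨γ 0, hi 0⟩)
      (p' : FundamentalGroupoid.mk (⟨x₀, hx j⟩ : U j) ⟶ FundamentalGroupoid.mk ⟨γ 0, hj 0⟩),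
      E (γ 1) i (hi 1) (p ≫ pathClass (codRestrictPath (U i) γ hi)) * (E (γ 0) i (hi 0) p)⁻¹
        = E (γ 1) j (hj 1) (p' ≫ pathClass (codRestrictPath (U j) γ hj))
          * (E (γ 0) j (hj 0) p')⁻¹ := by
    intro i j γ hi hj p p'
    obtain ⟨l⟩ := nonempty_hom_of_isPathConnected (hU2 i j) ⟨x₀, hx i, hx j⟩ ⟨γ 0, hi 0, hj 0⟩
    have h1 := hE' (γ 0) i j ⟨hi 0, hj 0⟩ l
    let q : FundamentalGroupoid.mk (⟨γ 0, hi 0, hj 0⟩ : ↑(U i ∩ U j)) ⟶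
      FundamentalGroupoid.mk ⟨γ 1, hi 1, hj 1⟩ :=
        pathClass (codRestrictPath (U i ∩ U j) γ fun r => ⟨hi r, hj r⟩)
    have h2 := hE' (γ 1) i j ⟨hi 1, hj 1⟩ (l ≫ q)
    refine (hquot i (hi 0) (hi 1) _ p (inclArrow inter_subset_left l)).trans ?_
    refine Eq.trans ?_ (hquot j (hj 0) (hj 1) _ p' (inclArrow inter_subset_right l)).symm
    rw [h1]
    exact congrArg (· * _) ((congrArg (E (γ 1) i (hi 1))
      (inclArrow_comp inter_subset_left l q).symm).trans
        (h2.trans (congrArg (E (γ 1) j (hj 1)) (inclArrow_comp inter_subset_right l q))))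
  classical
  have k : ∀ (i : J) (x : X) (h : x ∈ U i),
      FundamentalGroupoid.mk (⟨x₀, hx i⟩ : U i) ⟶ FundamentalGroupoid.mk ⟨x, h⟩ :=
    fun i x h => (nonempty_hom_of_isPathConnected (hconn i) ⟨x₀, hx i⟩ ⟨x, h⟩).some
  let val : C(I, X) → G := fun γ =>
    if h : ∃ i, ∀ r, γ r ∈ U i then
      E (γ 1) h.choose (h.choose_spec 1) (k h.choose (γ 0) (h.choose_spec 0) ≫
        pathClass (codRestrictPath (U h.choose) γ h.choose_spec)) *
      (E (γ 0) h.choose (h.choose_spec 0) (k h.choose (γ 0) (h.choose_spec 0)))⁻¹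
    else 1
  have hval : ∀ (i : J) (γ : C(I, X)) (hi : ∀ r, γ r ∈ U i)
      (p : FundamentalGroupoid.mk (⟨x₀, hx i⟩ : U i) ⟶ FundamentalGroupoid.mk ⟨γ 0, hi 0⟩),
      val γ = E (γ 1) i (hi 1) (p ≫ pathClass (codRestrictPath (U i) γ hi))
        * (E (γ 0) i (hi 0) p)⁻¹ := by
    intro i γ hi p
    have h : ∃ i, ∀ r, γ r ∈ U i := ⟨i, hi⟩
    simp only [val, dif_pos h]
    exact hloc _ _ _ _ _ _ _
  have hpath : ∀ (i : J) {x y : U i} (p : Path x y)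
      (a : FundamentalGroupoid.mk (⟨x₀, hx i⟩ : U i) ⟶ FundamentalGroupoid.mk x),
      val (p.map continuous_subtype_val) = E y i y.2 (a ≫
        (show FundamentalGroupoid.mk x ⟶ FundamentalGroupoid.mk y from
          Path.Homotopic.Quotient.mk p)) * (E x i x.2 a)⁻¹ := by
    rintro i x y ⟨γ, rfl, rfl⟩ a
    exact hval i ⟨fun r => (γ r : X), by fun_prop⟩ (fun r => (γ r).2) a
  let T : LocalTransport U G :=
    { val := val
      val_const := fun x => by
        obtain ⟨j, hj⟩ : ∃ j, x ∈ U j := mem_iUnion.1 (hcover ▸ mem_univ x)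
        rw [hval j (.const I x) (fun _ => hj) (k j x hj)]
        have h1 : pathClass (codRestrictPath (U j) (.const I x) fun _ => hj)
          = 𝟙 (FundamentalGroupoid.mk (⟨x, hj⟩ : U j)) := rfl
        exact (congrArg (fun z => E x j hj z * (E x j hj (k j x hj))⁻¹)
          (Category.comp_id (k j x hj))).trans (mul_inv_cancel _)
      val_square := fun i K hK => by
        let L : C(I × I, U i) := ⟨fun p => ⟨K p, hK p⟩, by fun_prop⟩
        let p := k i _ (hK (0, 0))
        let b : FundamentalGroupoid.mk (⟨K (0, 0), hK _⟩ : U i) ⟶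
          FundamentalGroupoid.mk ⟨K (1, 0), hK _⟩ := pathClass (horizontal L 0)
        let r : FundamentalGroupoid.mk (⟨K (1, 0), hK _⟩ : U i) ⟶
          FundamentalGroupoid.mk ⟨K (1, 1), hK _⟩ := pathClass (vertical L 1)
        let l : FundamentalGroupoid.mk (⟨K (0, 0), hK _⟩ : U i) ⟶
          FundamentalGroupoid.mk ⟨K (0, 1), hK _⟩ := pathClass (vertical L 0)
        let t : FundamentalGroupoid.mk (⟨K (0, 1), hK _⟩ : U i) ⟶
          FundamentalGroupoid.mk ⟨K (1, 1), hK _⟩ := pathClass (horizontal L 1)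
        have h : b ≫ r = l ≫ t := pathClass_square L
        have h1 := hval i (horizontal K 0) (fun r => hK (r, 0)) p
        have h2 := hval i (vertical K 1) (fun r => hK (1, r)) (p ≫ b)
        have h3 := hval i (vertical K 0) (fun r => hK (0, r)) p
        have h4 := hval i (horizontal K 1) (fun r => hK (r, 1)) (p ≫ l)
        -- The transports along consecutive edges telescope, so each way round the square depends
        -- only on its class in `U i`.
        have hcancel : ∀ a b c : G, a * b⁻¹ * (b * c⁻¹) = a * c⁻¹ := fun a b c => by group
        have hb : val (vertical K 1) * val (horizontal K 0) =
            E (K (1, 1)) i (hK (1, 1)) ((p ≫ b) ≫ r) *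
              (E (K (0, 0)) i (hK (0, 0)) p)⁻¹ := by
          rw [h1, h2]
          exact hcancel _ _ _
        have hl : val (horizontal K 1) * val (vertical K 0) =
            E (K (1, 1)) i (hK (1, 1)) ((p ≫ l) ≫ t) *
              (E (K (0, 0)) i (hK (0, 0)) p)⁻¹ := by
          rw [h3, h4]
          exact hcancel _ _ _
        rw [hb, hl, Category.assoc, Category.assoc, h] }
  obtain ⟨j₀, -⟩ : ∃ j, x₀ ∈ U j := mem_iUnion.1 (hcover ▸ mem_univ x₀)
  refine ⟨T, E x₀ j₀ (hx j₀) (𝟙 _), fun i p => ?_⟩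
  have h0 : E x₀ i (hx i) (𝟙 _) = E x₀ j₀ (hx j₀) (𝟙 _) :=
    hE' x₀ i j₀ ⟨hx i, hx j₀⟩ (𝟙 _)
  have h1 := hpath i p (𝟙 _)
  have h2 := hE x₀ i (hx i) (Path.Homotopic.Quotient.mk p) (𝟙 _)
  have h3 : (𝟙 _ : FundamentalGroupoid.mk (⟨x₀, hx i⟩ : U i) ⟶ _) ≫
      (show FundamentalGroupoid.mk (⟨x₀, hx i⟩ : U i) ⟶ FundamentalGroupoid.mk ⟨x₀, hx i⟩ from
        Path.Homotopic.Quotient.mk p)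
      = (show FundamentalGroupoid.mk (⟨x₀, hx i⟩ : U i) ⟶ FundamentalGroupoid.mk ⟨x₀, hx i⟩ from
        Path.Homotopic.Quotient.mk p) ≫ 𝟙 _ :=
    (Category.id_comp _).trans (Category.comp_id _).symm
  rw [h3] at h1
  refine h1.trans ?_
  rw [← h0]
  exact congrArg (· * _) h2

end

/-! ### The kernel of `Phi` -/

theorem N_le_ker {X J : Type*} [TopologicalSpace X] (U : J → Set X) (x₀ : X)
    (hx : ∀ j, x₀ ∈ U j) : N U x₀ hx ≤ (Phi U x₀ hx).ker := by
  refine Subgroup.normalClosure_le_normal ?_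
  rintro _ ⟨i, j, g, rfl⟩
  have h : ∀ j g, Phi U x₀ hx (toFreeProd U x₀ hx j g) = inclHom (U j) x₀ (hx j) g :=
    fun j g => Monoid.CoprodI.lift_of _ _
  rw [SetLike.mem_coe, MonoidHom.mem_ker, map_mul, map_inv, h, h, mul_inv_eq_one]
  induction g using Path.Homotopic.Quotient.ind
  rfl

theorem ker_le_N {X J : Type*} [TopologicalSpace X] (U : J → Set X) (x₀ : X)
    (hopen : ∀ j, IsOpen (U j)) (hconn : ∀ j, IsPathConnected (U j))
    (hcover : ⋃ j, U j = univ) (hx : ∀ j, x₀ ∈ U j)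
    (hU : ∀ i j k, IsPathConnected (U i ∩ U j ∩ U k)) :
    (Phi U x₀ hx).ker ≤ N U x₀ hx := by
  have : (N U x₀ hx).Normal := Subgroup.normalClosure_normal
  let f : ∀ j, FundamentalGroup (U j) ⟨x₀, hx j⟩ →* FreeProd U x₀ hx ⧸ N U x₀ hx :=
    fun j => (QuotientGroup.mk' _).comp (toFreeProd U x₀ hx j)
  have hf : Compatible f := fun i j g => by
    rw [← mul_inv_eq_one, ← map_inv]
    change QuotientGroup.mk' (N U x₀ hx) _ * QuotientGroup.mk' (N U x₀ hx) _ = 1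
    rw [map_inv, ← map_mul]
    exact (QuotientGroup.eq_one_iff _).2 (Subgroup.subset_normalClosure ⟨i, j, g, rfl⟩)
  obtain ⟨T, e, hT⟩ := hf.exists_localTransport hconn hcover hU
  -- On each factor the loop stays in one `U i`, so its holonomy is the local value `e * f i g *
  -- e⁻¹`. An element of `ker Phi` thus has trivial conjugate, hence trivial class, modulo `N`.
  have key : (T.toHom hopen hcover x₀).comp (Phi U x₀ hx)
      = (MulAut.conj e).toMonoidHom.comp (QuotientGroup.mk' (N U x₀ hx)) := by
    refine Monoid.CoprodI.ext_hom _ _ fun i => MonoidHom.ext fun g => ?_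
    induction g using Path.Homotopic.Quotient.ind with
    | mk p =>
      have h1 : Phi U x₀ hx (Monoid.CoprodI.of (Path.Homotopic.Quotient.mk p))
          = Path.Homotopic.Quotient.mk (p.map continuous_subtype_val) :=
        Monoid.CoprodI.lift_of _ _
      have h2 := T.holonomy_eq_val hopen hcover (i := i)
        (γ := (p.map continuous_subtype_val : Path x₀ x₀)) fun r => (p r).2
      exact (congrArg (T.toHom hopen hcover x₀) h1).trans (h2.trans (hT i p))
  intro w hw
  have h := DFunLike.congr_fun key w
  rw [MonoidHom.comp_apply, (MonoidHom.mem_ker).1 hw, map_one] at h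
  exact (QuotientGroup.eq_one_iff w).1 ((map_eq_one_iff (MulAut.conj e).toMonoidHom
    (MulAut.conj e).injective).1 h.symm)

/-! ### Surjectivity of `Phi` -/

/-- The morphism in the fundamental groupoid of `X` induced by one in that of a subspace. -/
def valArrow {X : Type*} [TopologicalSpace X] {A : Set X} {x y : X} {hx : x ∈ A} {hy : y ∈ A}
    (p : FundamentalGroupoid.mk (⟨x, hx⟩ : A) ⟶ FundamentalGroupoid.mk ⟨y, hy⟩) :
    FundamentalGroupoid.mk x ⟶ FundamentalGroupoid.mk y :=
  (FundamentalGroupoid.map ⟨Subtype.val, continuous_subtype_val⟩).map p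

theorem valArrow_comp {X : Type*} [TopologicalSpace X] {A : Set X} {x y z : X} {hx : x ∈ A}
    {hy : y ∈ A} {hz : z ∈ A}
    (p : FundamentalGroupoid.mk (⟨x, hx⟩ : A) ⟶ FundamentalGroupoid.mk ⟨y, hy⟩)
    (q : FundamentalGroupoid.mk (⟨y, hy⟩ : A) ⟶ FundamentalGroupoid.mk ⟨z, hz⟩) :
    valArrow (p ≫ q) = valArrow p ≫ valArrow q :=
  (FundamentalGroupoid.map ⟨Subtype.val, continuous_subtype_val⟩).map_comp p q

theorem valArrow_inv {X : Type*} [TopologicalSpace X] {A : Set X} {x y : X} {hx : x ∈ A}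
    {hy : y ∈ A} (p : FundamentalGroupoid.mk (⟨x, hx⟩ : A) ⟶ FundamentalGroupoid.mk ⟨y, hy⟩) :
    valArrow (Groupoid.inv p) = Groupoid.inv (valArrow p) := by
  induction p using Path.Homotopic.Quotient.ind
  rfl

theorem valArrow_inclArrow {X : Type*} [TopologicalSpace X] {A B : Set X} (h : A ⊆ B) {x y : X}
    {hx : x ∈ A} {hy : y ∈ A}
    (p : FundamentalGroupoid.mk (⟨x, hx⟩ : A) ⟶ FundamentalGroupoid.mk ⟨y, hy⟩) :
    valArrow (inclArrow h p) = valArrow p := by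
  induction p using Path.Homotopic.Quotient.ind
  rfl

/-- The class in the fundamental groupoid of the part of the path `γ` from time `s` to time `t`. -/
def subpathArrow {X : Type*} [TopologicalSpace X] {x y : X} (γ : Path x y) (s t : I) :
    FundamentalGroupoid.mk (γ s) ⟶ FundamentalGroupoid.mk (γ t) :=
  Path.Homotopic.Quotient.mk (γ.subpath s t)

theorem subpathArrow_comp {X : Type*} [TopologicalSpace X] {x y : X} (γ : Path x y) (r s t : I) :
    subpathArrow γ r s ≫ subpathArrow γ s t = subpathArrow γ r t :=
  Quotient.sound ⟨Path.Homotopy.subpathTransSubpath γ r s t⟩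

theorem exists_valArrow_eq_subpathArrow {X : Type*} [TopologicalSpace X] {x y : X} (γ : Path x y)
    {A : Set X} {s t : I} (hst : s ≤ t) (h : ∀ r ∈ Icc s t, γ r ∈ A) :
    ∃ q : FundamentalGroupoid.mk (⟨γ s, h s (left_mem_Icc.2 hst)⟩ : A) ⟶
      FundamentalGroupoid.mk ⟨γ t, h t (right_mem_Icc.2 hst)⟩, valArrow q = subpathArrow γ s t := by
  have hmem : ∀ r, γ.subpath s t r ∈ A := fun r => h _ (convexComb_mem_Icc hst r)
  exact ⟨Path.Homotopic.Quotient.mk ⟨⟨fun r => ⟨γ.subpath s t r, hmem r⟩, by fun_prop⟩,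
    Subtype.ext (γ.subpath s t).source, Subtype.ext (γ.subpath s t).target⟩, rfl⟩

theorem Phi_surjective {X J : Type*} [TopologicalSpace X] (U : J → Set X) (x₀ : X)
    (hopen : ∀ j, IsOpen (U j)) (hcover : ⋃ j, U j = univ) (hx : ∀ j, x₀ ∈ U j)
    (hU : ∀ i j, IsPathConnected (U i ∩ U j)) : Function.Surjective (Phi U x₀ hx) := by
  let R := (Phi U x₀ hx).range
  have hR : ∀ i (p : FundamentalGroupoid.mk (⟨x₀, hx i⟩ : U i) ⟶
      FundamentalGroupoid.mk ⟨x₀, hx i⟩), (show FundamentalGroup X x₀ from valArrow p) ∈ R :=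
    fun i p => ⟨toFreeProd U x₀ hx i p, Monoid.CoprodI.lift_of _ _⟩
  let Good : ∀ x : X, (FundamentalGroupoid.mk x₀ ⟶ FundamentalGroupoid.mk x) → Prop :=
    fun x w => ∀ i (hi : x ∈ U i)
      (p : FundamentalGroupoid.mk (⟨x₀, hx i⟩ : U i) ⟶ FundamentalGroupoid.mk ⟨x, hi⟩),
      (show FundamentalGroup X x₀ from w ≫ Groupoid.inv (valArrow p)) ∈ R
  -- A single return path suffices: passing from `p` to `q` through `k` in `U i ∩ U j` multiplies by
  -- a loop in `U i` and a loop in `U j`, both in the range.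
  have good_of_mem : ∀ {x : X} (i : J) (hi : x ∈ U i)
      (p : FundamentalGroupoid.mk (⟨x₀, hx i⟩ : U i) ⟶ FundamentalGroupoid.mk ⟨x, hi⟩)
      (w : FundamentalGroupoid.mk x₀ ⟶ FundamentalGroupoid.mk x),
      (show FundamentalGroup X x₀ from w ≫ Groupoid.inv (valArrow p)) ∈ R → Good x w := by
    intro x i hi p w h j hj q
    have hx₀ : x₀ ∈ U i ∩ U j := ⟨hx i, hx j⟩
    have hxij : x ∈ U i ∩ U j := ⟨hi, hj⟩
    obtain ⟨k⟩ := nonempty_hom_of_isPathConnected (hU i j) ⟨x₀, hx₀⟩ ⟨x, hxij⟩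
    have h1 := hR i (p ≫ Groupoid.inv (inclArrow inter_subset_left k))
    have h2 := hR j (inclArrow inter_subset_right k ≫ Groupoid.inv q)
    rw [valArrow_comp, valArrow_inv, valArrow_inclArrow] at h1 h2
    have h3 := R.mul_mem h2 (R.mul_mem h1 h)
    rw [End.mul_def, End.mul_def] at h3
    convert h3 using 1
    simp
  have good_subpath : ∀ {x y : X} (γ : Path x y)
      (w : FundamentalGroupoid.mk x₀ ⟶ FundamentalGroupoid.mk (γ 0)),
      Good (γ 0) (w ≫ subpathArrow γ 0 0) → Good (γ 1) (w ≫ subpathArrow γ 0 1) := by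
    intro x y γ w
    obtain ⟨δ, hδ, h⟩ := exists_dist_lt_mem hopen hcover (γ : C(I, X))
    -- Goodness of the initial part of `γ` is a `Prop`-valued function of time, constant because a
    -- short piece of `γ` in `U i` can be appended to the return path as well.
    refine (eq_of_forall_dist_lt (fun t => Good (γ t) (w ≫ subpathArrow γ 0 t)) hδ
      (fun s t hst hd => ?_) 0 1).mp
    obtain ⟨i, hi⟩ := h s
    have hi' : ∀ r ∈ Icc s t, γ r ∈ U i := fun r hr =>
      hi r ((dist_le_of_mem_Icc hr).trans_lt hd)
    obtain ⟨q, hq⟩ := exists_valArrow_eq_subpathArrow γ hst hi'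
    have hs := hi' s (left_mem_Icc.2 hst)
    have ht := hi' t (right_mem_Icc.2 hst)
    obtain ⟨p⟩ := nonempty_hom_of_isPathConnected (inter_self (U i) ▸ hU i i)
      ⟨x₀, hx i⟩ ⟨γ s, hs⟩
    have key : (w ≫ subpathArrow γ 0 s) ≫ Groupoid.inv (valArrow p)
        = (w ≫ subpathArrow γ 0 t) ≫ Groupoid.inv (valArrow (p ≫ q)) := by
      rw [valArrow_comp, hq, ← subpathArrow_comp γ 0 s t]
      simp
    refine propext ⟨fun H => good_of_mem i ht (p ≫ q) _ ?_, fun H => good_of_mem i hs p _ ?_⟩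
    · rw [← key]
      exact H i hs p
    · rw [key]
      exact H i ht (p ≫ q)
  have good_path : ∀ {x y : X} (γ : Path x y)
      (w : FundamentalGroupoid.mk x₀ ⟶ FundamentalGroupoid.mk x), Good x w →
      Good y (w ≫ (show FundamentalGroupoid.mk x ⟶ FundamentalGroupoid.mk y from
        Path.Homotopic.Quotient.mk γ)) := by
    rintro _ _ ⟨γ, rfl, rfl⟩ w h
    have := good_subpath ⟨γ, rfl, rfl⟩ w
    have e0 : subpathArrow ⟨γ, rfl, rfl⟩ 0 0 = 𝟙 (FundamentalGroupoid.mk (γ 0)) := by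
      rw [subpathArrow, Path.subpath_self]
      rfl
    have e1 : subpathArrow ⟨γ, rfl, rfl⟩ 0 1
        = pathClass γ := by
      rw [subpathArrow, Path.subpath_zero_one]
      rfl
    rw [e0, e1] at this
    exact this ((Category.comp_id w).symm ▸ h)
  intro g
  change g ∈ R
  induction g using Path.Homotopic.Quotient.ind with
  | mk γ =>
  obtain ⟨i, -⟩ : ∃ j, x₀ ∈ U j := mem_iUnion.1 (hcover ▸ mem_univ x₀)
  have h1 : Good x₀ (𝟙 _) := good_of_mem i (hx i) (𝟙 _) _ (by
    convert R.one_mem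
    exact Category.comp_id _)
  -- Closing up the loop `γ` with the constant return path leaves `γ` itself.
  have h2 := good_path γ (𝟙 _) h1 i (hx i) (𝟙 _)
  have h3 : ∀ a : FundamentalGroupoid.mk x₀ ⟶ FundamentalGroupoid.mk x₀, (𝟙 _ ≫ a) ≫
      Groupoid.inv (valArrow (𝟙 (FundamentalGroupoid.mk (⟨x₀, hx i⟩ : U i)))) = a := fun a => by
    have e : valArrow (𝟙 (FundamentalGroupoid.mk (⟨x₀, hx i⟩ : U i)))
      = 𝟙 (FundamentalGroupoid.mk x₀) := rfl
    rw [e]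
    simp
  exact (h3 (Path.Homotopic.Quotient.mk γ)) ▸ h2

end VanKampen

theorem mainTheorem2 {X J : Type*} [TopologicalSpace X] (U : J → Set X) (x₀ : X)
    (hopen : ∀ j, IsOpen (U j)) (hconn : ∀ j, IsPathConnected (U j))
    (hcover : ⋃ j, U j = Set.univ) (hx : ∀ j, x₀ ∈ U j) :
    ((∀ i j, IsPathConnected (U i ∩ U j)) →
      Function.Surjective (VanKampen.Phi U x₀ hx)) ∧
    ((∀ i j k, IsPathConnected (U i ∩ U j ∩ U k)) →
      (VanKampen.Phi U x₀ hx).ker = VanKampen.N U x₀ hx) := by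
  refine ⟨VanKampen.Phi_surjective U x₀ hopen hcover hx, fun hU => le_antisymm ?_ ?_⟩
  · exact VanKampen.ker_le_N U x₀ hopen hconn hcover hx hU
  · exact VanKampen.N_le_ker U x₀ hx
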